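/- Let $3 \le k \le N$. View $\sigma\in\mathcal S_N$ as a deck with card $\sigma(x)$ at position $x\in[N]=\{1,\dots,N\}$, let $\mu_N$ be the uniform distribution on $\mathcal S_N$, and let $$h_\sigma(x,y)=\#\{z\le x:\sigma(z)\le y\}-\frac{xy}{N}\qquad(x,y\in[N]).$$ Write $\sigma\succeq\sigma'$ if $h_\sigma(x,y)\ge h_{\sigma'}(x,y)$ for all $x,y\in[N]$. A function $f:\mathcal S_N\to\mathbb R$ is increasing if $\sigma\succeq\sigma'$ implies $f(\sigma)\ge f(\sigma')$, a set $A\subseteq\mathcal S_N$ is increasing if its indicator is, and a law $\mu$ stochastically dominates a law $\nu$ if $\mu(A)\ge\nu(A)$ for every increasing set $A$. In the $S_k$ shuffle, each block $[i,i+k-1]$, $1\le i\le N-k+1$, carries an independent Poisson clock of rate $1$; when a clock rings, the cards in its block are permuted by an independent uniform permutation. In the $S_k$ shuffle with boundaries, in addition, for each $2\le j\le k-1$ the block of the first $j$ positions and the block of the last $j$ positions each carry an independent Poisson clock of rate $\delta^{(k)}_j$, with the same rule, where $$\delta^{(k)}_{k-i}=\frac{4k^2-6ik+3i^2-1}{(2(k-i)+1)(2(k-i)-1)}\qquad(1\le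 i\le k-2).$$ A censoring scheme is a càdlàg function $\mathcal C$ from $[0,\infty)$ to the power set of the set of edges $\{\{x,x+1\}:1\le x\le N-1\}$. In the dynamics censored by $\mathcal C$, when the clock of a block $I$ rings at time $t$, the block $I$ is cut at all edges of $\mathcal C_t$ that it contains, and the cards in each of the resulting sub-intervals are permuted by independent uniform permutations (so that nothing changes if $I$ contains no edge of $\mathcal C_t$). Let $\nu_0$ be a probability distribution on $\mathcal S_N$ such that $\sigma\mapsto\nu_0(\sigma)/\mu_N(\sigma)$ is increasing, let $\mathcal C$ be a censoring scheme, and let $\nu_t^{\mathcal C}$ and $\nu_t$ be the laws at time $t$ of the $S_k$ shuffle started from $\nu_0$, with respect to $\mathcal C$ and without censoring. Then for every $t\ge0$: 1. $\sigma\mapsto\nu_t^{\mathcal C}(\sigma)/\mu_N(\sigma)$ is increasing; 2. (censoring inequality) $\nu_t^{\mathcal C}$ stochastically dominates $\nu_t$; moreover, for every family of ring times that, for each clock, is strictly increasing and tends to infinity, and in which no two rings are simultaneous, the conditional law of the censored dynamics at time $t$ given these ring times stochastically dominates the conditional law of the uncensored dynamics at time $t$ given the same ring times. Both statements also hold for the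 $S_k$ shuffle with boundaries. -/

import Mathlib

open MeasureTheory ProbabilityTheory Filter Topology
open scoped NNReal

namespace BlockShuffle

/-! ### Decks, heights and the order

Positions `1, …, N` and cards `1, …, N` are both indexed by `Fin N`, so that the element `x : Fin N`
stands for the number `x + 1`. A deck is a permutation `σ`, and `σ x` is the card at position `x`. -/

/-- A deck of `N` cards. -/
abbrev Deck (N : ℕ) : Type := Equiv.Perm (Fin N)

instance instMeasurableSpaceDeck (N : ℕ) : MeasurableSpace (Deck N) := ⊤

instance instDiscreteMeasurableSpaceDeck (N : ℕ) : DiscreteMeasurableSpace (Deck N) :=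
  ⟨fun _ => trivial⟩

/-- The height function `h_σ(x, y) = #{z ≤ x : σ(z) ≤ y} - x y / N`. -/
noncomputable def height {N : ℕ} (σ : Deck N) (x y : Fin N) : ℝ :=
  (((Finset.univ.filter fun z : Fin N => z ≤ x ∧ σ z ≤ y).card : ℕ) : ℝ)
    - (((x : ℕ) : ℝ) + 1) * (((y : ℕ) : ℝ) + 1) / (N : ℝ)

/-- `Dominates σ σ'` is `σ ⪰ σ'`. -/
def Dominates {N : ℕ} (σ σ' : Deck N) : Prop :=
  ∀ x y : Fin N, height σ x y ≥ height σ' x y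

/-- Increasing real functions on decks. -/
def IsIncreasing {N : ℕ} (f : Deck N → ℝ) : Prop :=
  ∀ σ σ' : Deck N, Dominates σ σ' → f σ ≥ f σ'

/-- Increasing sets of decks. -/
def IsIncreasingSet {N : ℕ} (A : Set (Deck N)) : Prop :=
  ∀ σ σ' : Deck N, Dominates σ σ' → σ' ∈ A → σ ∈ A

/-- `μ` stochastically dominates `ν`. -/
def StochDominates {N : ℕ} (μ ν : Measure (Deck N)) : Prop :=
  ∀ A : Set (Deck N), IsIncreasingSet A → μ A ≥ ν A

/-- The uniform distribution `μ_N` on decks. -/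
noncomputable def uniform (N : ℕ) : Measure (Deck N) := uniformOn Set.univ

/-- The density `σ ↦ ν(σ) / μ_N(σ)`. -/
noncomputable def density {N : ℕ} (ν : Measure (Deck N)) (σ : Deck N) : ℝ :=
  ν.real {σ} / (uniform N).real {σ}

/-! ### Censoring -/

/-- The edge `e : Edge N` joins the position `e` to the position `e + 1`. -/
abbrev Edge (N : ℕ) : Type := Fin (N - 1)

/-- A càdlàg function from `[0, ∞)` to the (finite, discrete) power set of the set of edges. -/
def IsCensoringScheme {N : ℕ} (C : ℝ≥0 → Finset (Edge N)) : Prop :=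
  (∀ t, ∀ᶠ s in 𝓝[>] t, C s = C t) ∧ ∀ t, ∃ c, ∀ᶠ s in 𝓝[<] t, C s = c

/-- Positions `x` and `y` are not separated by an edge of `c`, i.e. they lie on the same side of
each edge of `c`. For a block `I`, the classes of `I` under this relation are the maximal
sub-intervals of `I` that contain no edge of `c`. -/
def SameCell {N : ℕ} (c : Finset (Edge N)) (x y : Fin N) : Prop :=
  ∀ e ∈ c, ((x : ℕ) ≤ (e : ℕ) ↔ (y : ℕ) ≤ (e : ℕ))

/-- The permutations of positions that fix all positions outside the block `I` and map each of the
sub-intervals, into which the edges of `c` cut `I`, onto itself. A uniform element of this set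
consists of independent uniform permutations of the sub-intervals; if `I` contains no edge of `c`,
it is a uniform permutation of `I`. -/
def cellPerms {N : ℕ} (I : Finset (Fin N)) (c : Finset (Edge N)) : Set (Deck N) :=
  {π | (∀ x, x ∉ I → π x = x) ∧ ∀ x, x ∈ I → π x ∈ I ∧ SameCell c x (π x)}

/-! ### Shuffles driven by Poisson clocks -/

/-- The block of `l` consecutive positions that starts at position `a`. -/
def interval (N a l : ℕ) : Finset (Fin N) :=
  Finset.univ.filter fun x : Fin N => a ≤ (x : ℕ) ∧ (x : ℕ) < a + l

/-- A finite collection of blocks, each with a Poisson clock of the given rate. -/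
structure Shuffle (N : ℕ) where
  Clock : Type
  finite_clock : Finite Clock
  block : Clock → Finset (Fin N)
  rate : Clock → ℝ
  rate_pos : ∀ b, 0 < rate b

/-- The `S_k` shuffle: each of the `N - k + 1` blocks of `k` consecutive positions has rate `1`. -/
def skShuffle (N k : ℕ) : Shuffle N where
  Clock := Fin (N - k + 1)
  finite_clock := inferInstance
  block i := interval N i k
  rate _ := 1
  rate_pos _ := one_pos

/-- The boundary rate `δ_j^{(k)}`: with `i = k - j`, this is
`(4k² - 6ik + 3i² - 1) / ((2(k - i) + 1) (2(k - i) - 1))`. -/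
noncomputable def boundaryRate (k j : ℕ) : ℝ :=
  let i : ℝ := (k : ℝ) - (j : ℝ)
  (4 * (k : ℝ) ^ 2 - 6 * i * (k : ℝ) + 3 * i ^ 2 - 1)
    / ((2 * ((k : ℝ) - i) + 1) * (2 * ((k : ℝ) - i) - 1))

theorem boundaryRate_pos (k j : ℕ) (hj : 2 ≤ j) : 0 < boundaryRate k j := by
  have h : (2 : ℝ) ≤ (j : ℝ) := by exact_mod_cast hj
  unfold boundaryRate
  apply div_pos
  · nlinarith [sq_nonneg (k : ℝ)]
  · apply mul_pos <;> linarith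

/-- The `S_k` shuffle with boundaries: in addition to the blocks of the `S_k` shuffle, for each
`2 ≤ j ≤ k - 1` the blocks of the first `j` and of the last `j` positions have rate `δ_j^{(k)}`.
Here `j` is written as `j₀ + 2` with `j₀ : Fin (k - 2)`. -/
noncomputable def skShuffleWithBoundaries (N k : ℕ) : Shuffle N where
  Clock := Fin (N - k + 1) ⊕ (Fin (k - 2) ⊕ Fin (k - 2))
  finite_clock := inferInstance
  block
    | Sum.inl i => interval N i k
    | Sum.inr (Sum.inl j) => interval N 0 ((j : ℕ) + 2)
    | Sum.inr (Sum.inr j) => interval N (N - ((j : ℕ) + 2)) ((j : ℕ) + 2)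
  rate
    | Sum.inl _ => 1
    | Sum.inr (Sum.inl j) => boundaryRate k ((j : ℕ) + 2)
    | Sum.inr (Sum.inr j) => boundaryRate k ((j : ℕ) + 2)
  rate_pos
    | Sum.inl _ => one_pos
    | Sum.inr (Sum.inl _) => boundaryRate_pos k _ (Nat.le_add_left 2 _)
    | Sum.inr (Sum.inr _) => boundaryRate_pos k _ (Nat.le_add_left 2 _)

namespace Shuffle

variable {N : ℕ} (S : Shuffle N)

/-- A ring `(b, n)` is the `n`-th ring (counted from `0`) of the clock `b`. -/
abbrev Ring : Type := S.Clock × ℕ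

/-- Times of all rings. -/
abbrev Times : Type := S.Ring → ℝ≥0

/-- The permutation that is applied at a given ring when the current set of censored edges is
`c`. -/
abbrev Marks : Type := S.Ring × Finset (Edge N) → Deck N

/-- The law of the waiting times before the rings: independent, exponential with the rate of the
clock. -/
noncomputable def gapLaw : Measure (S.Ring → ℝ≥0) :=
  Measure.infinitePi fun e => (expMeasure (S.rate e.1)).map Real.toNNReal

/-- The ring times of a clock are the partial sums of its waiting times. -/
def timesOfGaps (g : S.Ring → ℝ≥0) : S.Times :=
  fun e => ∑ m ∈ Finset.range (e.2 + 1), g (e.1, m)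

/-- The law of the ring times of independent Poisson clocks with the given rates. -/
noncomputable def timesLaw : Measure S.Times := S.gapLaw.map S.timesOfGaps

/-- The marks are independent and uniform on the permutations allowed by the block and the censored
edges. -/
noncomputable def markLaw : Measure S.Marks :=
  Measure.infinitePi fun m => uniformOn (cellPerms (S.block m.1.1) m.2)

/-- The rings up to time `t` in their order in time. The list is unique if it exists. It exists if
the rings up to time `t` are finitely many at distinct times, which has probability one; otherwise
the value is irrelevant. -/
noncomputable def ringList (τ : S.Times) (t : ℝ≥0) : List S.Ring :=
  open Classical in
  if h : ∃ l : List S.Ring, l.Pairwise (fun e e' => τ e < τ e') ∧ ∀ e, e ∈ l ↔ τ e ≤ t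
  then h.choose else []

/-- The state at time `t` of the dynamics censored by `C`, started from `η₀`, with ring times `τ`
and marks `u`: at each ring, the cards in the block are permuted by the mark, so that `η` becomes
`x ↦ η (π x)`. -/
noncomputable def run (C : ℝ≥0 → Finset (Edge N)) (t : ℝ≥0) (η₀ : Deck N) (τ : S.Times)
    (u : S.Marks) : Deck N :=
  (S.ringList τ t).foldl (fun η e => η * u (e, C (τ e))) η₀

/-- The law at time `t` of the censored dynamics started from `ν₀`. -/
noncomputable def law (C : ℝ≥0 → Finset (Edge N)) (ν₀ : Measure (Deck N)) (t : ℝ≥0) :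
    Measure (Deck N) :=
  (ν₀.prod (S.timesLaw.prod S.markLaw)).map fun ω => S.run C t ω.1 ω.2.1 ω.2.2

/-- The law at time `t` of the censored dynamics started from `ν₀`, conditionally on the ring times
being `τ`. As the initial state and the marks are independent of the clocks, this is the law of the
state with `τ` held fixed. -/
noncomputable def condLaw (C : ℝ≥0 → Finset (Edge N)) (ν₀ : Measure (Deck N)) (τ : S.Times)
    (t : ℝ≥0) : Measure (Deck N) :=
  (ν₀.prod S.markLaw).map fun ω => S.run C t ω.1 τ ω.2

/-- The uncensored dynamics is the one with no censored edges. -/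
def noCensoring : ℝ≥0 → Finset (Edge N) := fun _ => ∅

/-- Possible families of ring times: the rings of each clock come in order and do not accumulate,
and no two rings happen at the same time. -/
def SuitableTimes (τ : S.Times) : Prop :=
  (∀ b, StrictMono fun n => τ (b, n)) ∧ (∀ b, Tendsto (fun n => τ (b, n)) atTop atTop) ∧
    Function.Injective τ

/-- The censoring inequality: at each time the law of the censored dynamics stochastically dominates
the law of the original dynamics, and so it does conditionally on the ring times, whatever these
are. -/
def CensoringInequality (C : ℝ≥0 → Finset (Edge N)) (ν₀ : Measure (Deck N)) : Prop :=
  (∀ t, StochDominates (S.law C ν₀ t) (S.law noCensoring ν₀ t)) ∧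
    ∀ t τ, S.SuitableTimes τ →
      StochDominates (S.condLaw C ν₀ τ t) (S.condLaw noCensoring ν₀ τ t)

end Shuffle

end BlockShuffle

/-!
A ring of the block `I` with censored edges `c` multiplies the deck on the right by a uniform
element of the subgroup `H = cellGroup I c`, so that it replaces the probability mass function of
the deck by its average `cosetAvg H` over the cosets `σ H`. Everything follows from two properties of such an
average for increasing `f` and `g` (`IsAdjacentlyGenerated.cosetAvg_properties`): `cosetAvg H f` is
increasing, and `∑ cosetAvg H f * g ≤ ∑ f * g`.

If `H` consists of the identity and one transposition of adjacent positions, then the first property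
is the lifting property of the Bruhat order (`Dominates.lift`), and the second one is Chebyshev's
inequality on the cosets, each of which is a pair of comparable decks (`sum_pairAvg_mul_le`). In
general, since blocks are intervals, `H` is generated by transpositions of adjacent positions
(`isAdjacentlyGenerated_cellGroup`), and the properties pass from the transpositions to `H`: the
functions obtained from `f` by averaging over transpositions in `H` lie in a closed set defined by
the two properties and by having the same averages over cosets, and the element of minimal norm in
this set has to be `cosetAvg H f`.

For fixed ring times, the first property shows that the mass function of the censored dynamics stays
increasing. For the comparison (`Shuffle.sum_densityList_le`), let `p` and `q` be the mass functions
of the uncensored and the censored dynamics before a ring, and let `P` and `P'` be the averages over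
the whole block and over the censored block. Since `P P' = P` and `P` is self-adjoint,
`∑ P p * g = ∑ p * P g ≤ ∑ q * P g = ∑ P (P' q) * g ≤ ∑ P' q * g` for every increasing `g`.

Finally, the law of the dynamics is a mixture over the ring times of the conditional laws
(`Shuffle.law_apply`). This needs that the state is a measurable function of the initial deck, the
ring times and the marks, which holds because a censoring scheme is right-continuous.
-/

namespace BlockShuffle

variable {N : ℕ}

/-! ### The order and adjacent transpositions -/

/-- The number of cards with value at most `y` among the first `a` positions. In contrast to
`height`, the number of positions may be `0`, so that one can pass from `a` to `a + 1`. -/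
def lowCount (σ : Deck N) (a : ℕ) (y : Fin N) : ℕ :=
  (Finset.univ.filter fun z : Fin N => (z : ℕ) < a ∧ σ z ≤ y).card

theorem dominates_iff_lowCount {σ σ' : Deck N} :
    Dominates σ σ' ↔ ∀ a y, lowCount σ' a y ≤ lowCount σ a y := by
  have key : ∀ (ρ : Deck N) (x y : Fin N), height ρ x y =
      (lowCount ρ (x + 1) y : ℝ) - (((x : ℕ) : ℝ) + 1) * (((y : ℕ) : ℝ) + 1) / (N : ℝ) := by
    intro ρ x y
    have h : ∀ z : Fin N, z ≤ x ↔ (z : ℕ) < x + 1 := fun z => by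
      rw [Fin.le_def]; omega
    simp only [height, lowCount, h]
  constructor
  · intro h a y
    rcases Nat.eq_zero_or_pos a with rfl | ha
    · simp [lowCount]
    -- Rows beyond the last position agree with the last row.
    have hmin : ∀ ρ : Deck N, lowCount ρ a y = lowCount ρ (min (a - 1) (N - 1) + 1) y := by
      intro ρ
      have h : ∀ z : Fin N, (z : ℕ) < a ↔ (z : ℕ) < min (a - 1) (N - 1) + 1 := fun z => by
        have := z.isLt; omega
      simp only [lowCount, h]
    have hN : min (a - 1) (N - 1) < N := by have := y.isLt; omega
    have hxy := h ⟨min (a - 1) (N - 1), hN⟩ y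
    rw [key, key] at hxy
    rw [hmin, hmin]
    have : (lowCount σ' (min (a - 1) (N - 1) + 1) y : ℝ)
        ≤ lowCount σ (min (a - 1) (N - 1) + 1) y := by linarith
    exact_mod_cast this
  · intro h x y
    rw [key, key]
    have : (lowCount σ' (x + 1) y : ℝ) ≤ lowCount σ (x + 1) y := by exact_mod_cast h _ _
    linarith

theorem Dominates.trans {σ σ' σ'' : Deck N} (h : Dominates σ σ') (h' : Dominates σ' σ'') :
    Dominates σ σ'' := fun x y => le_trans (h' x y) (h x y)

theorem lowCount_succ (σ : Deck N) (a : Fin N) (y : Fin N) :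
    lowCount σ (a + 1) y = lowCount σ a y + if σ a ≤ y then 1 else 0 := by
  have h : (Finset.univ.filter fun z : Fin N => (z : ℕ) < a + 1 ∧ σ z ≤ y) =
      (Finset.univ.filter fun z : Fin N => (z : ℕ) < a ∧ σ z ≤ y) ∪
        (Finset.univ.filter fun z : Fin N => z = a ∧ σ a ≤ y) := by
    ext z
    simp only [Finset.mem_filter, Finset.mem_univ, true_and, Finset.mem_union]
    constructor
    · rintro ⟨h1, h2⟩
      rcases Nat.lt_succ_iff_lt_or_eq.mp h1 with h | h
      · exact Or.inl ⟨h, h2⟩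
      · have := Fin.ext h
        subst this
        exact Or.inr ⟨rfl, h2⟩
    · rintro (⟨h1, h2⟩ | ⟨rfl, h2⟩)
      · exact ⟨by omega, h2⟩
      · exact ⟨by omega, h2⟩
  unfold lowCount
  rw [h, Finset.card_union_of_disjoint]
  · congr 1
    split_ifs with hy
    · simp [hy, Finset.filter_eq']
    · simp [hy]
  · rw [Finset.disjoint_left]
    intro z hz hz'
    simp only [Finset.mem_filter, Finset.mem_univ, true_and] at hz hz'
    rw [hz'.1] at hz
    omega

/-- Exchanging the cards at positions `i` and `i + 1` changes only the row between them. -/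
theorem lowCount_mul_swap (σ : Deck N) {i j : Fin N} (hij : (j : ℕ) = i + 1) {a : ℕ}
    (ha : a ≠ j) (y : Fin N) : lowCount (σ * Equiv.swap i j) a y = lowCount σ a y := by
  unfold lowCount
  refine Finset.card_equiv (Equiv.swap i j) fun z => ?_
  rw [Finset.mem_filter, Finset.mem_filter, Equiv.Perm.mul_apply]
  simp only [Finset.mem_univ, true_and]
  refine and_congr_left fun _ => ?_
  rcases eq_or_ne z i with rfl | hi
  · rw [Equiv.swap_apply_left]; omega
  rcases eq_or_ne z j with rfl | hj
  · rw [Equiv.swap_apply_right]; omega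
  · rw [Equiv.swap_apply_of_ne_of_ne hi hj]

/-- Domination of two decks, of which one or both are modified by the exchange of the cards at
positions `i` and `j = i + 1`, has to be checked only in the row between these positions. -/
theorem dominates_of_row {σ σ' ρ ρ' : Deck N} {i j : Fin N} (hij : (j : ℕ) = i + 1)
    (h : Dominates σ σ') (hρ : ρ = σ ∨ ρ = σ * Equiv.swap i j)
    (hρ' : ρ' = σ' ∨ ρ' = σ' * Equiv.swap i j)
    (hrow : ∀ y, lowCount σ' i y ≤ lowCount σ i y →
      lowCount σ' i y + (if σ' i ≤ y then 1 else 0) + (if σ' j ≤ y then 1 else 0) ≤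
        lowCount σ i y + (if σ i ≤ y then 1 else 0) + (if σ j ≤ y then 1 else 0) →
      lowCount σ' i y + (if ρ' i ≤ y then 1 else 0) ≤
        lowCount σ i y + (if ρ i ≤ y then 1 else 0)) :
    Dominates ρ ρ' := by
  rw [dominates_iff_lowCount] at h ⊢
  have hne : ∀ (τ τ' : Deck N), (τ' = τ ∨ τ' = τ * Equiv.swap i j) → ∀ a, a ≠ (j : ℕ) → ∀ y,
      lowCount τ' a y = lowCount τ a y := by
    rintro τ τ' (rfl | rfl) a ha y
    · rfl
    · exact lowCount_mul_swap τ hij ha y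
  intro a y
  by_cases ha : a = j
  · subst ha
    rw [hij, lowCount_succ, lowCount_succ, hne σ ρ hρ _ (by omega), hne σ' ρ' hρ' _ (by omega)]
    refine hrow y (h _ _) ?_
    have h2 := h (j + 1) y
    rw [lowCount_succ, lowCount_succ, hij, lowCount_succ, lowCount_succ] at h2
    exact h2
  · rw [hne σ ρ hρ a ha, hne σ' ρ' hρ' a ha]
    exact h a y

theorem dominates_refl (σ : Deck N) : Dominates σ σ := fun _ _ => le_rfl

theorem dominates_mul_swap {σ : Deck N} {i j : Fin N} (hij : (j : ℕ) = i + 1) (h : σ i < σ j) :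
    Dominates σ (σ * Equiv.swap i j) := by
  refine dominates_of_row hij (dominates_refl σ) (Or.inl rfl) (Or.inr rfl) fun y _ _ => ?_
  simp only [Equiv.Perm.mul_apply, Equiv.swap_apply_left]
  have : σ j ≤ y → σ i ≤ y := fun hy => h.le.trans hy
  split_ifs <;> omega

theorem mul_swap_dominates {σ : Deck N} {i j : Fin N} (hij : (j : ℕ) = i + 1) (h : σ j < σ i) :
    Dominates (σ * Equiv.swap i j) σ := by
  refine dominates_of_row hij (dominates_refl σ) (Or.inr rfl) (Or.inl rfl) fun y _ _ => ?_
  simp only [Equiv.Perm.mul_apply, Equiv.swap_apply_left]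
  have : σ i ≤ y → σ j ≤ y := fun hy => h.le.trans hy
  split_ifs <;> omega

/-- The lifting property of the Bruhat order: for comparable decks, the pairs obtained by exchanging
two adjacent cards can be matched monotonically. -/
theorem Dominates.lift {σ σ' : Deck N} (h : Dominates σ σ') {i j : Fin N}
    (hij : (j : ℕ) = i + 1) :
    Dominates (σ * Equiv.swap i j) (σ' * Equiv.swap i j) ∨
      (Dominates σ (σ' * Equiv.swap i j) ∧ Dominates (σ * Equiv.swap i j) σ') := by
  have hne : i ≠ j := fun h => by rw [h] at hij; omega
  rcases lt_or_gt_of_ne (σ.injective.ne hne) with h1 | h1 <;>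
    rcases lt_or_gt_of_ne (σ'.injective.ne hne) with h2 | h2
  · left
    refine dominates_of_row hij h (Or.inr rfl) (Or.inr rfl) fun y hp hq => ?_
    simp only [Equiv.Perm.mul_apply, Equiv.swap_apply_left]
    have h1' : σ j ≤ y → σ i ≤ y := fun hy => h1.le.trans hy
    have h2' : σ' j ≤ y → σ' i ≤ y := fun hy => h2.le.trans hy
    split_ifs at hq ⊢ <;> omega
  · right
    constructor
    · refine dominates_of_row hij h (Or.inl rfl) (Or.inr rfl) fun y hp hq => ?_
      simp only [Equiv.Perm.mul_apply, Equiv.swap_apply_left]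
      have h1' : σ j ≤ y → σ i ≤ y := fun hy => h1.le.trans hy
      split_ifs at hq ⊢ <;> omega
    · refine dominates_of_row hij h (Or.inr rfl) (Or.inl rfl) fun y hp hq => ?_
      simp only [Equiv.Perm.mul_apply, Equiv.swap_apply_left]
      have h2' : σ' i ≤ y → σ' j ≤ y := fun hy => h2.le.trans hy
      split_ifs at hq ⊢ <;> omega
  · left
    exact ((mul_swap_dominates hij h1).trans h).trans (dominates_mul_swap hij h2)
  · left
    refine dominates_of_row hij h (Or.inr rfl) (Or.inr rfl) fun y hp hq => ?_
    simp only [Equiv.Perm.mul_apply, Equiv.swap_apply_left]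
    have h1' : σ i ≤ y → σ j ≤ y := fun hy => h1.le.trans hy
    have h2' : σ' i ≤ y → σ' j ≤ y := fun hy => h2.le.trans hy
    split_ifs at hq ⊢ <;> omega

/-! ### Averaging over one transposition -/

/-- Average of `f` over the two decks `σ` and `σ * s`. -/
noncomputable def pairAvg (s : Deck N) (f : Deck N → ℝ) (σ : Deck N) : ℝ :=
  (f σ + f (σ * s)) / 2

theorem IsIncreasing.pairAvg {f : Deck N → ℝ} (hf : IsIncreasing f) {i j : Fin N}
    (hij : (j : ℕ) = i + 1) : IsIncreasing (pairAvg (Equiv.swap i j) f) := by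
  intro σ σ' h
  unfold BlockShuffle.pairAvg
  rcases h.lift hij with h' | ⟨h1, h2⟩
  · linarith [hf _ _ h, hf _ _ h']
  · linarith [hf _ _ h1, hf _ _ h2]

theorem sum_mul_right (s : Deck N) (f : Deck N → ℝ) : ∑ σ, f (σ * s) = ∑ σ, f σ :=
  Equiv.sum_comp (Equiv.mulRight s) f

/-- Chebyshev's association inequality on the comparable pairs `{σ, σ * s}`. -/
theorem sum_pairAvg_mul_le {f g : Deck N → ℝ} (hf : IsIncreasing f) (hg : IsIncreasing g)
    {i j : Fin N} (hij : (j : ℕ) = i + 1) :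
    ∑ σ, pairAvg (Equiv.swap i j) f σ * g σ ≤ ∑ σ, f σ * g σ := by
  set s := Equiv.swap i j with hs
  have hss : ∀ σ : Deck N, σ * s * s = σ := fun σ => by rw [mul_assoc, Equiv.swap_mul_self, mul_one]
  have hne : i ≠ j := fun h => by rw [h] at hij; omega
  have hpos : 0 ≤ ∑ σ, (f σ - f (σ * s)) * (g σ - g (σ * s)) := by
    refine Finset.sum_nonneg fun σ _ => ?_
    rcases lt_or_gt_of_ne (σ.injective.ne hne) with h | h
    · have hd := dominates_mul_swap hij h
      exact mul_nonneg (sub_nonneg.2 (hf _ _ hd)) (sub_nonneg.2 (hg _ _ hd))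
    · have hd := mul_swap_dominates hij h
      exact mul_nonneg_of_nonpos_of_nonpos (sub_nonpos.2 (hf _ _ hd)) (sub_nonpos.2 (hg _ _ hd))
  have e1 : ∑ σ, f (σ * s) * g (σ * s) = ∑ σ, f σ * g σ :=
    sum_mul_right s fun σ => f σ * g σ
  have e2 : ∑ σ, f (σ * s) * g σ = ∑ σ, f σ * g (σ * s) := by
    rw [← sum_mul_right s fun σ => f (σ * s) * g σ]
    simp only [hss]
  have e3 : ∑ σ, (f σ - f (σ * s)) * (g σ - g (σ * s)) =
      ∑ σ, f σ * g σ - ∑ σ, f σ * g (σ * s) - ∑ σ, f (σ * s) * g σ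
        + ∑ σ, f (σ * s) * g (σ * s) := by
    rw [← Finset.sum_sub_distrib, ← Finset.sum_sub_distrib, ← Finset.sum_add_distrib]
    exact Finset.sum_congr rfl fun σ _ => by ring
  have e4 : ∑ σ, BlockShuffle.pairAvg s f σ * g σ =
      (∑ σ, f σ * g σ + ∑ σ, f (σ * s) * g σ) / 2 := by
    rw [← Finset.sum_add_distrib, Finset.sum_div]
    exact Finset.sum_congr rfl fun σ _ => by unfold BlockShuffle.pairAvg; ring
  linarith

/-! ### Averaging over cosets of a subgroup -/

open Classical in
/-- Average of `f` over the coset `σ H`. -/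
noncomputable def cosetAvg (H : Subgroup (Deck N)) (f : Deck N → ℝ) (σ : Deck N) : ℝ :=
  (∑ π : H, f (σ * π)) / Fintype.card H

theorem cosetAvg_translate (H : Subgroup (Deck N)) (f : Deck N → ℝ) (σ : Deck N) {τ : Deck N}
    (hτ : τ ∈ H) : cosetAvg H (fun ρ => f (ρ * τ)) σ = cosetAvg H f σ := by
  classical
  unfold cosetAvg
  rw [← Equiv.sum_comp (Equiv.mulRight (⟨τ, hτ⟩ : H)) fun π : H => f (σ * π)]
  simp [mul_assoc]

theorem cosetAvg_of_invariant (H : Subgroup (Deck N)) {f : Deck N → ℝ}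
    (hf : ∀ π ∈ H, ∀ σ, f (σ * π) = f σ) : cosetAvg H f = f := by
  classical
  funext σ
  unfold cosetAvg
  rw [Finset.sum_congr rfl fun (π : H) _ => hf π π.2 σ]
  have : (Fintype.card H : ℝ) ≠ 0 := by exact_mod_cast Fintype.card_ne_zero
  rw [Finset.sum_const, Finset.card_univ, nsmul_eq_mul]
  field_simp

theorem cosetAvg_cosetAvg {K H : Subgroup (Deck N)} (hKH : K ≤ H) (f : Deck N → ℝ) :
    cosetAvg H (cosetAvg K f) = cosetAvg H f := by
  classical
  funext σ
  have h1 : cosetAvg H (cosetAvg K f) σ =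
      (∑ κ : K, cosetAvg H (fun ρ => f (ρ * κ)) σ) / Fintype.card K := by
    simp only [cosetAvg, Finset.sum_div]
    rw [Finset.sum_comm]
    exact Finset.sum_congr rfl fun _ _ => Finset.sum_congr rfl fun _ _ => by ring
  rw [h1, Finset.sum_congr rfl fun κ _ => cosetAvg_translate H f σ (hKH κ.2)]
  have : (Fintype.card K : ℝ) ≠ 0 := by exact_mod_cast Fintype.card_ne_zero
  rw [Finset.sum_const, Finset.card_univ, nsmul_eq_mul]
  field_simp

theorem cosetAvg_pairAvg {H : Subgroup (Deck N)} {s : Deck N} (hs : s ∈ H) (f : Deck N → ℝ) :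
    cosetAvg H (pairAvg s f) = cosetAvg H f := by
  classical
  funext σ
  have h1 : cosetAvg H (pairAvg s f) σ =
      (cosetAvg H f σ + cosetAvg H (fun ρ => f (ρ * s)) σ) / 2 := by
    simp only [cosetAvg, pairAvg, ← add_div, ← Finset.sum_add_distrib, ← Finset.sum_div]
    ring
  rw [h1, cosetAvg_translate H f σ hs]
  ring

theorem sum_cosetAvg_mul (H : Subgroup (Deck N)) (f g : Deck N → ℝ) :
    ∑ σ, cosetAvg H f σ * g σ = ∑ σ, f σ * cosetAvg H g σ := by
  classical
  simp only [cosetAvg, div_mul_eq_mul_div, mul_div_assoc', ← Finset.sum_div]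
  congr 1
  simp only [Finset.sum_mul, Finset.mul_sum]
  rw [Finset.sum_comm, Finset.sum_comm (s := (Finset.univ : Finset (Deck N))),
    ← Equiv.sum_comp (Equiv.inv H)]
  refine Finset.sum_congr rfl fun π _ => ?_
  rw [← sum_mul_right (π : Deck N)]
  simp [mul_assoc]

/-- Generated by the transpositions of adjacent positions that it contains. -/
def IsAdjacentlyGenerated (H : Subgroup (Deck N)) : Prop :=
  H = Subgroup.closure {s | s ∈ H ∧ ∃ i j : Fin N, (j : ℕ) = i + 1 ∧ s = Equiv.swap i j}

theorem continuous_cosetAvg (H : Subgroup (Deck N)) (σ : Deck N) :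
    Continuous fun f : Deck N → ℝ => cosetAvg H f σ := by
  unfold cosetAvg
  fun_prop

/-- The average over the cosets of `H` is a limit of compositions of averages over adjacent
transpositions in `H`, so that it inherits monotonicity and Chebyshev's inequality from these.
Instead of a limit, the proof takes the function of minimal `ℓ²` norm in the closed set of the
functions that share these properties and the averages over cosets: averaging it over a further
transposition cannot decrease its norm, so that it is constant on cosets. -/
theorem IsAdjacentlyGenerated.cosetAvg_properties {H : Subgroup (Deck N)}
    (hH : IsAdjacentlyGenerated H) {f : Deck N → ℝ} (hf : IsIncreasing f) :
    IsIncreasing (cosetAvg H f) ∧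
      ∀ g, IsIncreasing g → ∑ σ, cosetAvg H f σ * g σ ≤ ∑ σ, f σ * g σ := by
  let K : Set (Deck N → ℝ) := {h | IsIncreasing h ∧
    (∀ g, IsIncreasing g → ∑ σ, h σ * g σ ≤ ∑ σ, f σ * g σ) ∧ cosetAvg H h = cosetAvg H f}
  have hKc : IsClosed K := by
    have h1 : IsClosed {h : Deck N → ℝ | ∀ σ σ', Dominates σ σ' → h σ ≥ h σ'} := by
      simp only [Set.ofPred_forall]
      exact isClosed_iInter fun σ => isClosed_iInter fun σ' => isClosed_iInter fun _ =>
        isClosed_le (by fun_prop) (by fun_prop)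
    have h2 : IsClosed {h : Deck N → ℝ |
        ∀ g, IsIncreasing g → ∑ σ, h σ * g σ ≤ ∑ σ, f σ * g σ} := by
      simp only [Set.ofPred_forall]
      exact isClosed_iInter fun g => isClosed_iInter fun _ =>
        isClosed_le (by fun_prop) (by fun_prop)
    have h3 : IsClosed {h : Deck N → ℝ | cosetAvg H h = cosetAvg H f} :=
      isClosed_eq (continuous_pi fun σ => continuous_cosetAvg H σ) continuous_const
    exact h1.inter (h2.inter h3)
  have hfK : f ∈ K := ⟨hf, fun _ _ => le_rfl, rfl⟩
  have hKs : ∀ h ∈ K, ∀ i j : Fin N, (j : ℕ) = i + 1 → Equiv.swap i j ∈ H →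
      pairAvg (Equiv.swap i j) h ∈ K := fun h hh i j hij hs =>
    ⟨hh.1.pairAvg hij, fun g hg => (sum_pairAvg_mul_le hh.1 hg hij).trans (hh.2.1 g hg),
      (cosetAvg_pairAvg hs h).trans hh.2.2⟩
  obtain ⟨h, hhK, hmin⟩ : ∃ h ∈ K, ∀ h' ∈ K, ∑ σ, h σ ^ 2 ≤ ∑ σ, h' σ ^ 2 := by
    let K' : Set (EuclideanSpace ℝ (Deck N)) := {v | v.ofLp ∈ K}
    have hK' : IsClosed K' := hKc.preimage (PiLp.continuous_ofLp 2 _)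
    obtain ⟨v, hv, hd⟩ := hK'.exists_infDist_eq_dist ⟨WithLp.toLp 2 f, hfK⟩ 0
    refine ⟨v.ofLp, hv, fun h' hh' => ?_⟩
    have h1 : dist 0 v ≤ dist 0 (WithLp.toLp 2 h') := by
      rw [← hd]
      exact Metric.infDist_le_dist_of_mem (show WithLp.toLp 2 h' ∈ K' from hh')
    rw [dist_zero_left, dist_zero_left] at h1
    have h2 := pow_le_pow_left₀ (norm_nonneg _) h1 2
    simpa [EuclideanSpace.norm_sq_eq] using h2
  have hinv : ∀ i j : Fin N, (j : ℕ) = i + 1 → Equiv.swap i j ∈ H →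
      ∀ σ, h (σ * Equiv.swap i j) = h σ := by
    intro i j hij hs
    have hle := hmin _ (hKs h hhK i j hij hs)
    have e1 := sum_mul_right (Equiv.swap i j) fun σ => h σ ^ 2
    -- The parallelogram identity for `h` and its translate.
    have e2 : ∑ σ, pairAvg (Equiv.swap i j) h σ ^ 2 +
        (∑ σ, (h (σ * Equiv.swap i j) - h σ) ^ 2) / 4 =
        (∑ σ, h σ ^ 2 + ∑ σ, h (σ * Equiv.swap i j) ^ 2) / 2 := by
      rw [← Finset.sum_add_distrib, Finset.sum_div, Finset.sum_div, ← Finset.sum_add_distrib]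
      exact Finset.sum_congr rfl fun σ _ => by unfold pairAvg; ring
    have hnn : ∀ σ ∈ Finset.univ, 0 ≤ (h (σ * Equiv.swap i j) - h σ) ^ 2 :=
      fun σ _ => sq_nonneg _
    have h0 : ∑ σ, (h (σ * Equiv.swap i j) - h σ) ^ 2 = 0 :=
      le_antisymm (by linarith) (Finset.sum_nonneg hnn)
    intro σ
    have := (Finset.sum_eq_zero_iff_of_nonneg hnn).1 h0 σ (Finset.mem_univ σ)
    exact sub_eq_zero.1 (pow_eq_zero_iff two_ne_zero |>.1 this)
  have hinvH : ∀ π ∈ H, ∀ σ, h (σ * π) = h σ := by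
    intro π hπ
    rw [hH] at hπ
    induction hπ using Subgroup.closure_induction with
    | mem s hs =>
      obtain ⟨hs, i, j, hij, rfl⟩ := hs
      exact hinv i j hij hs
    | one => simp
    | mul a b _ _ ha hb => intro σ; rw [← mul_assoc, hb, ha]
    | inv a _ ha => intro σ; rw [← ha (σ * a⁻¹), inv_mul_cancel_right]
  have hfin : cosetAvg H f = h := by rw [← hhK.2.2, cosetAvg_of_invariant H hinvH]
  rw [hfin]
  exact ⟨hhK.1, hhK.2.1⟩

/-! ### The subgroup of a censored block -/

/-- The permutations allowed at a ring form a subgroup. -/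
def cellGroup (I : Finset (Fin N)) (c : Finset (Edge N)) : Subgroup (Deck N) where
  carrier := cellPerms I c
  one_mem' := ⟨fun _ _ => rfl, fun _ hx => ⟨hx, fun _ _ => Iff.rfl⟩⟩
  mul_mem' {a b} ha hb :=
    ⟨fun x hx => by rw [Equiv.Perm.mul_apply, hb.1 x hx, ha.1 x hx], fun x hx =>
      ⟨(ha.2 _ (hb.2 x hx).1).1, fun e he =>
        ((hb.2 x hx).2 e he).trans ((ha.2 _ (hb.2 x hx).1).2 e he)⟩⟩
  inv_mem' {a} ha := by
    have haa : ∀ x, a (a⁻¹ x) = x := fun x => a.apply_symm_apply x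
    have hmem : ∀ x ∈ I, a⁻¹ x ∈ I := fun x hx => by
      by_contra h
      have := ha.1 _ h
      rw [haa] at this
      exact h (this ▸ hx)
    refine ⟨fun x hx => ?_, fun x hx => ⟨hmem x hx, fun e he => ?_⟩⟩
    · rw [Equiv.Perm.inv_eq_iff_eq, ha.1 x hx]
    · have := (ha.2 _ (hmem x hx)).2 e he
      rw [haa] at this
      exact this.symm

theorem cellGroup_le (I : Finset (Fin N)) (c : Finset (Edge N)) :
    cellGroup I c ≤ cellGroup I ∅ := fun _ hπ =>
  ⟨hπ.1, fun x hx => ⟨(hπ.2 x hx).1, fun e he => absurd he (Finset.notMem_empty e)⟩⟩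

theorem swap_mem_cellGroup {I : Finset (Fin N)} {c : Finset (Edge N)} {x y : Fin N} (hx : x ∈ I)
    (hy : y ∈ I) (h : SameCell c x y) : Equiv.swap x y ∈ cellGroup I c := by
  refine ⟨fun z hz => Equiv.swap_apply_of_ne_of_ne (fun h => hz (h ▸ hx)) fun h => hz (h ▸ hy),
    fun z hz => ?_⟩
  rcases eq_or_ne z x with rfl | hzx
  · rw [Equiv.swap_apply_left]; exact ⟨hy, h⟩
  rcases eq_or_ne z y with rfl | hzy
  · rw [Equiv.swap_apply_right]; exact ⟨hx, fun e he => (h e he).symm⟩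
  · rw [Equiv.swap_apply_of_ne_of_ne hzx hzy]; exact ⟨hz, fun _ _ => Iff.rfl⟩

theorem isAdjacentlyGenerated_cellGroup {I : Finset (Fin N)} (hI : (I : Set (Fin N)).OrdConnected)
    (c : Finset (Edge N)) : IsAdjacentlyGenerated (cellGroup I c) := by
  set S := {s | s ∈ cellGroup I c ∧ ∃ i j : Fin N, (j : ℕ) = i + 1 ∧ s = Equiv.swap i j}
  refine le_antisymm (fun π hπ => ?_) ((Subgroup.closure_le _).2 fun s hs => hs.1)
  have hSw : ∀ s ∈ S, s.IsSwap := by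
    rintro s ⟨-, i, j, hij, rfl⟩
    exact ⟨i, j, fun h => by rw [h] at hij; omega, rfl⟩
  -- Within a cell, one can walk from one position to any other by adjacent transpositions.
  have hwalk : ∀ (d : ℕ) (x y : Fin N), (y : ℕ) = x + d → x ∈ I → y ∈ I → SameCell c x y →
      y ∈ MulAction.orbit (Subgroup.closure S) x := by
    intro d
    induction d with
    | zero =>
      intro x y hxy _ _ _
      rw [Fin.ext (by omega : (y : ℕ) = x)]
      exact MulAction.mem_orbit_self x
    | succ d ih =>
      intro x y hxy hx hy hc
      let z : Fin N := ⟨x + d, by have := y.isLt; omega⟩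
      have hzx : x ≤ z := Fin.le_def.2 (by simp [z])
      have hzy : z ≤ y := Fin.le_def.2 (by simp only [z]; omega)
      have hz : z ∈ I := hI.out hx hy ⟨hzx, hzy⟩
      have hxz : SameCell c x z := fun e he =>
        ⟨fun h => (Fin.le_def.1 hzy).trans ((hc e he).1 h), fun h => (Fin.le_def.1 hzx).trans h⟩
      have hzyc : SameCell c z y := fun e he => (hxz e he).symm.trans (hc e he)
      have h1 := ih x z rfl hx hz hxz
      have hs : Equiv.swap z y ∈ Subgroup.closure S := Subgroup.subset_closure
        ⟨swap_mem_cellGroup hz hy hzyc, z, y, by simp only [z]; omega, rfl⟩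
      have h2 : y ∈ MulAction.orbit (Subgroup.closure S) z :=
        ⟨⟨_, hs⟩, Equiv.swap_apply_left z y⟩
      rwa [MulAction.orbit_eq_iff.2 h1] at h2
  refine (mem_closure_isSwap hSw).2 ⟨Set.toFinite _, fun x => ?_⟩
  by_cases hx : x ∈ I
  · obtain ⟨h1, h2⟩ := hπ.2 x hx
    rcases le_total (x : ℕ) (π x) with h | h
    · exact hwalk (π x - x) x (π x) (by omega) hx h1 h2
    · exact MulAction.mem_orbit_symm.1
        (hwalk (x - π x) (π x) x (by omega) h1 hx fun e he => (h2 e he).symm)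
  · rw [hπ.1 x hx]
    exact MulAction.mem_orbit_self x

theorem ordConnected_interval (N a l : ℕ) : (interval N a l : Set (Fin N)).OrdConnected := by
  refine ⟨fun x hx y hy z hz => ?_⟩
  simp only [interval, Finset.coe_filter, Finset.mem_univ, true_and, Set.mem_ofPred_eq] at *
  have h1 := Fin.le_def.1 hz.1
  have h2 := Fin.le_def.1 hz.2
  omega

/-! ### Densities and stochastic domination -/

theorem uniformOn_real_singleton (H : Subgroup (Deck N)) [DecidablePred (· ∈ H)] (π : Deck N) :
    (uniformOn (H : Set (Deck N))).real {π} =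
      if π ∈ H then (Fintype.card H : ℝ)⁻¹ else 0 := by
  have hc : Measure.count (H : Set (Deck N)) = (Fintype.card H : ENNReal) := by
    rw [Measure.count_apply (MeasurableSet.of_discrete), Set.encard_eq_coe_toFinset_card,
      Set.toFinset_card]
    simp
  rw [measureReal_def, uniformOn, cond_apply MeasurableSet.of_discrete, hc]
  split_ifs with h
  · rw [Set.inter_eq_self_of_subset_right (Set.singleton_subset_iff.2 h), Measure.count_singleton]
    simp
  · rw [Set.inter_singleton_eq_empty.2 h]
    simp

/-- The uniform distribution has constant mass. -/
theorem isIncreasing_density_iff (ν : Measure (Deck N)) :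
    IsIncreasing (density ν) ↔ IsIncreasing fun σ => ν.real {σ} := by
  classical
  have h : ∀ σ, (uniform N).real {σ} = (Fintype.card (⊤ : Subgroup (Deck N)) : ℝ)⁻¹ := fun σ => by
    have := uniformOn_real_singleton (⊤ : Subgroup (Deck N)) σ
    rw [if_pos (Subgroup.mem_top σ)] at this
    rw [← this, uniform, Subgroup.coe_top]
  have hpos : (0 : ℝ) < Fintype.card (⊤ : Subgroup (Deck N)) := by
    exact_mod_cast Fintype.card_pos
  simp only [IsIncreasing, density, h, div_inv_eq_mul, ge_iff_le, mul_le_mul_iff_left₀ hpos]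

theorem stochDominates_of_sum_le {μ ν : Measure (Deck N)} [IsFiniteMeasure μ] [IsFiniteMeasure ν]
    (h : ∀ g, IsIncreasing g → ∑ σ, ν.real {σ} * g σ ≤ ∑ σ, μ.real {σ} * g σ) :
    StochDominates μ ν := by
  classical
  intro A hA
  have hsum : ∀ ρ : Measure (Deck N), [IsFiniteMeasure ρ] →
      ρ.real A = ∑ σ, ρ.real {σ} * (if σ ∈ A then 1 else 0) := by
    intro ρ _
    have : ((Finset.univ.filter (· ∈ A) : Finset (Deck N)) : Set (Deck N)) = A := by ext; simp
    conv_lhs => rw [← this]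
    rw [← sum_measureReal_singleton]
    simp [Finset.sum_filter]
  have hg : IsIncreasing fun σ => if σ ∈ A then (1 : ℝ) else 0 := by
    intro σ σ' hd
    by_cases h' : σ' ∈ A
    · simp [h', hA σ σ' hd h']
    · simp only [h', if_false]
      split_ifs <;> norm_num
  have := h _ hg
  rw [← hsum, ← hsum] at this
  exact (ENNReal.toReal_le_toReal (measure_ne_top _ _) (measure_ne_top _ _)).1 this

theorem measurable_mul_deck {Ω : Type*} [MeasurableSpace Ω] {X Y : Ω → Deck N}
    (hX : Measurable X) (hY : Measurable Y) : Measurable fun ω => X ω * Y ω :=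
  (Measurable.of_discrete (f := fun p : Deck N × Deck N => p.1 * p.2)).comp (hX.prodMk hY)

/-- Multiplying a random deck by an independent uniform element of `H` averages its law over the
cosets of `H`. -/
theorem map_mul_real_singleton {Ω : Type*} [MeasurableSpace Ω] {P : Measure Ω}
    [IsProbabilityMeasure P] {X Y : Ω → Deck N} (hX : Measurable X) (hY : Measurable Y)
    (h : IndepFun X Y P) {H : Subgroup (Deck N)} (hH : P.map Y = uniformOn (H : Set (Deck N)))
    (σ : Deck N) :
    (P.map fun ω => X ω * Y ω).real {σ} = cosetAvg H (fun ρ => (P.map X).real {ρ}) σ := by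
  classical
  have hXY := measurable_mul_deck hX hY
  have hE : MeasurableSet ((fun ω => X ω * Y ω) ⁻¹' {σ}) := hXY MeasurableSet.of_discrete
  set E := (fun ω => X ω * Y ω) ⁻¹' {σ} with hEdef
  have hterm : ∀ π : Deck N, (P.restrict E).real (Y ⁻¹' {π}) =
      (P.map X).real {σ * π⁻¹} * (if π ∈ H then (Fintype.card H : ℝ)⁻¹ else 0) := by
    intro π
    have hset : Y ⁻¹' {π} ∩ E = X ⁻¹' {σ * π⁻¹} ∩ Y ⁻¹' {π} := by
      ext ω
      simp only [hEdef, Set.mem_inter_iff, Set.mem_preimage, Set.mem_singleton_iff]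
      constructor
      · rintro ⟨rfl, h2⟩
        exact ⟨by rw [← h2, mul_inv_cancel_right], rfl⟩
      · rintro ⟨h1, rfl⟩
        exact ⟨rfl, by rw [h1, inv_mul_cancel_right]⟩
    rw [measureReal_restrict_apply (hY MeasurableSet.of_discrete), hset, measureReal_def,
      h.measure_inter_preimage_eq_mul _ _ MeasurableSet.of_discrete MeasurableSet.of_discrete,
      ENNReal.toReal_mul, ← uniformOn_real_singleton, ← hH,
      map_measureReal_apply hX MeasurableSet.of_discrete,
      map_measureReal_apply hY MeasurableSet.of_discrete]
    rfl
  have htot : P.real E = ∑ π : Deck N, (P.restrict E).real (Y ⁻¹' {π}) := by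
    rw [sum_measureReal_preimage_singleton _ fun π _ => hY MeasurableSet.of_discrete]
    simp
  rw [map_measureReal_apply hXY MeasurableSet.of_discrete, htot,
    Finset.sum_congr rfl fun π _ => hterm π]
  simp only [mul_ite, mul_zero, cosetAvg, ← div_eq_mul_inv]
  rw [← Finset.sum_filter, Finset.sum_div, ← Equiv.sum_comp (Equiv.inv H)]
  exact Finset.sum_subtype (p := (· ∈ H)) _ (fun x => by simp)
    (fun π => (P.map X).real {σ * π⁻¹} / (Fintype.card H : ℝ))

namespace Shuffle

variable (S : Shuffle N)

/-! ### The dynamics with fixed ring times -/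

/-- The state reached from `η₀` by the rings in `l`, in this order. -/
def runList (C : ℝ≥0 → Finset (Edge N)) (τ : S.Times) (l : List S.Ring) (η₀ : Deck N)
    (u : S.Marks) : Deck N :=
  l.foldl (fun η e => η * u (e, C (τ e))) η₀

/-- The effect of the rings in `l`, in this order, on the probability mass function of the state. -/
noncomputable def densityList (C : ℝ≥0 → Finset (Edge N)) (τ : S.Times) (l : List S.Ring)
    (p : Deck N → ℝ) : Deck N → ℝ :=
  l.foldl (fun p e => cosetAvg (cellGroup (S.block e.1) (C (τ e))) p) p

/-- All blocks are intervals of positions. -/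
def HasIntervalBlocks : Prop := ∀ b, (S.block b : Set (Fin N)).OrdConnected

variable {S}

theorem isIncreasing_densityList (hS : S.HasIntervalBlocks) (C : ℝ≥0 → Finset (Edge N))
    (τ : S.Times) (l : List S.Ring) {p : Deck N → ℝ} (hp : IsIncreasing p) :
    IsIncreasing (S.densityList C τ l p) := by
  induction l generalizing p with
  | nil => exact hp
  | cons e l ih =>
    exact ih ((isAdjacentlyGenerated_cellGroup (hS e.1) _).cosetAvg_properties hp).1

/-- At each ring, the censored average is followed in the uncensored dynamics by a further average
over the whole block, which moves an increasing density downwards; the average over the block is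
self-adjoint and preserves increasing test functions. -/
theorem sum_densityList_le (hS : S.HasIntervalBlocks) (C : ℝ≥0 → Finset (Edge N)) (τ : S.Times)
    (l : List S.Ring) {p g : Deck N → ℝ} (hp : IsIncreasing p) (hg : IsIncreasing g) :
    ∑ σ, S.densityList noCensoring τ l p σ * g σ ≤ ∑ σ, S.densityList C τ l p σ * g σ := by
  induction l using List.reverseRecOn generalizing g with
  | nil => exact le_rfl
  | append_singleton l e ih =>
    set B := S.block e.1
    have hB := isAdjacentlyGenerated_cellGroup (hS e.1) ∅
    have h0 : S.densityList noCensoring τ (l ++ [e]) p =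
        cosetAvg (cellGroup B ∅) (S.densityList noCensoring τ l p) := by
      simp [densityList, noCensoring, B]
    have h1 : S.densityList C τ (l ++ [e]) p =
        cosetAvg (cellGroup B (C (τ e))) (S.densityList C τ l p) := by
      simp [densityList, B]
    have hq := isIncreasing_densityList hS C τ l hp
    have hq' := ((isAdjacentlyGenerated_cellGroup (hS e.1) (C (τ e))).cosetAvg_properties hq).1
    calc ∑ σ, S.densityList noCensoring τ (l ++ [e]) p σ * g σ
        = ∑ σ, S.densityList noCensoring τ l p σ * cosetAvg (cellGroup B ∅) g σ := by
          rw [h0, sum_cosetAvg_mul]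
      _ ≤ ∑ σ, S.densityList C τ l p σ * cosetAvg (cellGroup B ∅) g σ :=
          ih (hB.cosetAvg_properties hg).1
      _ = ∑ σ, cosetAvg (cellGroup B ∅)
            (cosetAvg (cellGroup B (C (τ e))) (S.densityList C τ l p)) σ * g σ := by
          rw [cosetAvg_cosetAvg (cellGroup_le B _), sum_cosetAvg_mul]
      _ ≤ ∑ σ, cosetAvg (cellGroup B (C (τ e))) (S.densityList C τ l p) σ * g σ :=
          (hB.cosetAvg_properties hq').2 g hg
      _ = ∑ σ, S.densityList C τ (l ++ [e]) p σ * g σ := by rw [h1]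

instance instIsProbabilityMeasureMark (m : S.Ring × Finset (Edge N)) :
    IsProbabilityMeasure (uniformOn (cellPerms (S.block m.1.1) m.2)) :=
  isProbabilityMeasure_uniformOn (Set.toFinite _) ⟨1, (cellGroup (S.block m.1.1) m.2).one_mem⟩

instance instIsProbabilityMeasureMarkLaw : IsProbabilityMeasure S.markLaw := by
  unfold markLaw; infer_instance

theorem measurable_runList (C : ℝ≥0 → Finset (Edge N)) (τ : S.Times) (l : List S.Ring) :
    Measurable fun ω : Deck N × S.Marks => S.runList C τ l ω.1 ω.2 := by
  induction l using List.reverseRecOn with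
  | nil => exact measurable_fst
  | append_singleton l e ih =>
    simp only [runList, List.foldl_append, List.foldl_cons, List.foldl_nil]
    exact measurable_mul_deck ih ((measurable_pi_apply _).comp measurable_snd)

theorem runList_congr (C : ℝ≥0 → Finset (Edge N)) (τ : S.Times) (l : List S.Ring) (η₀ : Deck N)
    {u u' : S.Marks} (h : ∀ e ∈ l, u (e, C (τ e)) = u' (e, C (τ e))) :
    S.runList C τ l η₀ u = S.runList C τ l η₀ u' := by
  induction l generalizing η₀ with
  | nil => rfl
  | cons e l ih =>
    simp only [runList, List.foldl_cons] at ih ⊢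
    rw [h e List.mem_cons_self]
    exact ih _ fun e' he' => h e' (List.mem_cons_of_mem _ he')

/-- The marks of different rings are independent. -/
theorem indepFun_runList_mark (C : ℝ≥0 → Finset (Edge N)) (τ : S.Times) {l : List S.Ring}
    {e : S.Ring} (he : e ∉ l) (η₀ : Deck N) :
    IndepFun (fun u : S.Marks => S.runList C τ l η₀ u) (fun u => u (e, C (τ e))) S.markLaw := by
  classical
  have hi : iIndepFun (fun (m : S.Ring × Finset (Edge N)) (u : S.Marks) => u m) S.markLaw :=
    iIndepFun_infinitePi (X := fun _ π => π) fun _ => measurable_id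
  let T : Finset (S.Ring × Finset (Edge N)) := (l.map fun e' => (e', C (τ e'))).toFinset
  have hT : Disjoint T {(e, C (τ e))} := by
    rw [Finset.disjoint_singleton_right]
    intro h
    obtain ⟨e', he', heq⟩ := List.mem_map.1 (List.mem_toFinset.1 h)
    have hee : e' = e := (Prod.ext_iff.1 heq).1
    exact he (hee ▸ he')
  have h := hi.indepFun_finset T {(e, C (τ e))} hT fun m => measurable_pi_apply m
  -- The state after the rings in `l` depends only on the marks in `T`.
  let ext : (T → Deck N) → S.Marks := fun v m => if hm : m ∈ T then v ⟨m, hm⟩ else 1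
  have h' := h.comp (φ := fun v => S.runList C τ l η₀ (ext v))
    (ψ := fun v => v ⟨(e, C (τ e)), Finset.mem_singleton_self _⟩)
    (measurable_of_countable _) (measurable_of_countable _)
  have hext : (fun u : S.Marks => S.runList C τ l η₀ u) =
      (fun v => S.runList C τ l η₀ (ext v)) ∘ fun (u : S.Marks) (m : T) => u m := by
    funext u
    refine runList_congr C τ l η₀ fun e' he' => ?_
    have : (e', C (τ e')) ∈ T := List.mem_toFinset.2 (List.mem_map.2 ⟨e', he', rfl⟩)
    simp [ext, this]
  rw [hext]
  exact h'

theorem map_runList_real_singleton (C : ℝ≥0 → Finset (Edge N)) (τ : S.Times) {l : List S.Ring}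
    (hl : l.Nodup) (ν₀ : Measure (Deck N)) [IsProbabilityMeasure ν₀] :
    (fun σ => ((ν₀.prod S.markLaw).map fun ω => S.runList C τ l ω.1 ω.2).real {σ}) =
      S.densityList C τ l fun σ => ν₀.real {σ} := by
  induction l using List.reverseRecOn with
  | nil =>
    funext σ
    have : (ν₀.prod S.markLaw).map (fun ω => S.runList C τ [] ω.1 ω.2) = ν₀ := by
      change (ν₀.prod S.markLaw).map Prod.fst = ν₀
      simp
    rw [this]
    rfl
  | append_singleton l e ih =>
    have hle := List.nodup_append.1 hl
    have he : e ∉ l := fun h => hle.2.2 e h e (List.mem_singleton_self e) rfl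
    have hX := measurable_runList C τ l
    have hY : Measurable fun ω : Deck N × S.Marks => ω.2 (e, C (τ e)) :=
      (measurable_pi_apply _).comp measurable_snd
    have hmap : (ν₀.prod S.markLaw).map (fun ω => ω.2 (e, C (τ e))) =
        uniformOn (cellGroup (S.block e.1) (C (τ e)) : Set (Deck N)) := by
      have h1 : (ν₀.prod S.markLaw).map Prod.snd = S.markLaw := by simp
      have h2 := Measure.map_map (μ := ν₀.prod S.markLaw)
        (measurable_pi_apply (X := fun _ : S.Ring × Finset (Edge N) => Deck N) (e, C (τ e)))
        measurable_snd
      rw [h1] at h2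
      exact h2.symm.trans (Measure.infinitePi_map_eval _ _)
    have hind : IndepFun (fun ω : Deck N × S.Marks => S.runList C τ l ω.1 ω.2)
        (fun ω => ω.2 (e, C (τ e))) (ν₀.prod S.markLaw) := by
      rw [indepFun_iff_measure_inter_preimage_eq_mul]
      intro A B hA hB
      have hsnd : (ν₀.prod S.markLaw) ((fun ω => ω.2 (e, C (τ e))) ⁻¹' B) =
          S.markLaw ((fun u => u (e, C (τ e))) ⁻¹' B) := by
        have h1 : (ν₀.prod S.markLaw).map Prod.snd = S.markLaw := by simp
        conv_rhs => rw [← h1]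
        have hm : Measurable fun u : S.Marks => u (e, C (τ e)) := measurable_pi_apply _
        rw [Measure.map_apply measurable_snd (hm hB)]
        rfl
      rw [hsnd, Measure.prod_apply ((hX hA).inter (hY hB)), Measure.prod_apply (hX hA),
        ← lintegral_mul_const _ (measurable_measure_prodMk_left (hX hA))]
      exact lintegral_congr fun η =>
        (indepFun_runList_mark C τ he η).measure_inter_preimage_eq_mul A B hA hB
    have h1 : S.densityList C τ (l ++ [e]) (fun σ => ν₀.real {σ}) =
        cosetAvg (cellGroup (S.block e.1) (C (τ e)))
          (S.densityList C τ l fun σ => ν₀.real {σ}) := by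
      simp [densityList]
    rw [h1, ← ih hle.1]
    funext σ
    rw [← map_mul_real_singleton hX hY hind hmap σ]
    simp [runList]

theorem ringList_nodup (τ : S.Times) (t : ℝ≥0) : (S.ringList τ t).Nodup := by
  unfold ringList
  split_ifs with h
  · exact h.choose_spec.1.imp fun hlt heq => by rw [heq] at hlt; exact lt_irrefl _ hlt
  · exact List.nodup_nil

theorem condLaw_real_singleton (C : ℝ≥0 → Finset (Edge N)) (ν₀ : Measure (Deck N))
    [IsProbabilityMeasure ν₀] (τ : S.Times) (t : ℝ≥0) :
    (fun σ => (S.condLaw C ν₀ τ t).real {σ}) =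
      S.densityList C τ (S.ringList τ t) fun σ => ν₀.real {σ} :=
  map_runList_real_singleton C τ (ringList_nodup τ t) ν₀

instance instIsFiniteMeasureCondLaw (C : ℝ≥0 → Finset (Edge N)) (ν₀ : Measure (Deck N))
    [IsProbabilityMeasure ν₀] (τ : S.Times) (t : ℝ≥0) : IsFiniteMeasure (S.condLaw C ν₀ τ t) := by
  unfold condLaw; infer_instance

theorem isIncreasing_condLaw (hS : S.HasIntervalBlocks) (C : ℝ≥0 → Finset (Edge N))
    {ν₀ : Measure (Deck N)} [IsProbabilityMeasure ν₀] (hν₀ : IsIncreasing (density ν₀))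
    (τ : S.Times) (t : ℝ≥0) : IsIncreasing fun σ => (S.condLaw C ν₀ τ t).real {σ} := by
  rw [condLaw_real_singleton]
  exact isIncreasing_densityList hS C τ _ ((isIncreasing_density_iff ν₀).1 hν₀)

theorem stochDominates_condLaw (hS : S.HasIntervalBlocks) (C : ℝ≥0 → Finset (Edge N))
    {ν₀ : Measure (Deck N)} [IsProbabilityMeasure ν₀] (hν₀ : IsIncreasing (density ν₀))
    (τ : S.Times) (t : ℝ≥0) :
    StochDominates (S.condLaw C ν₀ τ t) (S.condLaw noCensoring ν₀ τ t) := by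
  refine stochDominates_of_sum_le fun g hg => ?_
  have h := sum_densityList_le hS C τ (S.ringList τ t) ((isIncreasing_density_iff ν₀).1 hν₀) hg
  rw [← condLaw_real_singleton, ← condLaw_real_singleton] at h
  exact h

/-! ### Averaging over the ring times -/

/-- A right-continuous function into a discrete space is measurable, as the pointwise limit of
functions that are constant on the intervals `[m / (n + 1), (m + 1) / (n + 1))`. -/
theorem measurableSet_censoring_eq {C : ℝ≥0 → Finset (Edge N)} (hC : IsCensoringScheme C)
    (c : Finset (Edge N)) : MeasurableSet {t | C t = c} := by
  let r : ℕ → ℝ≥0 → ℝ≥0 := fun n t => ((⌊t * (n + 1)⌋₊ : ℝ≥0) + 1) / (n + 1)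
  have hpos : ∀ n : ℕ, (0 : ℝ≥0) < n + 1 := fun n => by positivity
  have hlt : ∀ n t, t < r n t := fun n t => by
    rw [lt_div_iff₀ (hpos n)]
    exact Nat.lt_floor_add_one _
  have hle : ∀ n t, r n t ≤ t + 1 / (n + 1) := fun n t => by
    rw [div_le_iff₀ (hpos n), add_mul, one_div, inv_mul_cancel₀ (hpos n).ne']
    gcongr
    exact Nat.floor_le zero_le
  have hr : ∀ t, Tendsto (fun n => r n t) atTop (𝓝[>] t) := fun t => by
    refine tendsto_nhdsWithin_iff.2 ⟨?_, Eventually.of_forall fun n => hlt n t⟩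
    have h0 : Tendsto (fun n : ℕ => t + 1 / ((n : ℝ≥0) + 1)) atTop (𝓝 (t + 0)) :=
      tendsto_const_nhds.add tendsto_one_div_add_atTop_nhds_zero_nat
    rw [add_zero] at h0
    exact tendsto_of_tendsto_of_tendsto_of_le_of_le tendsto_const_nhds h0
      (fun n => (hlt n t).le) fun n => hle n t
  have heq : {t | C t = c} = ⋃ n₀ : ℕ, ⋂ n : ℕ, ⋂ (_ : n₀ ≤ n), {t | C (r n t) = c} := by
    ext t
    have ht : ∀ᶠ n in atTop, C (r n t) = C t := (hr t).eventually (hC.1 t)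
    simp only [Set.mem_iUnion, Set.mem_iInter, Set.mem_ofPred_eq]
    constructor
    · intro h
      obtain ⟨n₀, hn₀⟩ := eventually_atTop.1 ht
      exact ⟨n₀, fun n hn => (hn₀ n hn).trans h⟩
    · rintro ⟨n₀, hn₀⟩
      obtain ⟨n, hn, hn'⟩ := (ht.and (eventually_ge_atTop n₀)).exists
      exact hn.symm.trans (hn₀ n hn')
  rw [heq]
  refine MeasurableSet.iUnion fun n₀ => MeasurableSet.iInter fun n => MeasurableSet.iInter fun _ =>
    ?_
  have hfl : Measurable fun t : ℝ≥0 => ⌊t * (n + 1)⌋₊ :=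
    Nat.measurable_floor.comp (measurable_id.mul_const _)
  exact hfl (MeasurableSet.of_discrete (s := {m : ℕ | C (((m : ℝ≥0) + 1) / (n + 1)) = c}))

theorem ringList_eq_of {τ : S.Times} {t : ℝ≥0} {l : List S.Ring}
    (hl : l.Pairwise (fun e e' => τ e < τ e') ∧ ∀ e, e ∈ l ↔ τ e ≤ t) : S.ringList τ t = l := by
  have h : ∃ l : List S.Ring, l.Pairwise (fun e e' => τ e < τ e') ∧ ∀ e, e ∈ l ↔ τ e ≤ t := ⟨l, hl⟩
  unfold ringList
  rw [dif_pos h]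
  have hnd : ∀ {l : List S.Ring}, l.Pairwise (fun e e' => τ e < τ e') → l.Nodup := fun hp =>
    hp.imp fun hlt heq => by rw [heq] at hlt; exact lt_irrefl _ hlt
  have hperm : h.choose.Perm l := (List.perm_ext_iff_of_nodup (hnd h.choose_spec.1) (hnd hl.1)).2
    fun e => (h.choose_spec.2 e).trans (hl.2 e).symm
  exact hperm.eq_of_pairwise (fun a b _ _ h1 h2 => absurd h1 (lt_asymm h2)) h.choose_spec.1 hl.1

instance instCountableRing : Countable S.Ring :=
  haveI := S.finite_clock
  inferInstance

theorem measurableSet_pairwise_lt (l : List S.Ring) :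
    MeasurableSet {τ : S.Times | l.Pairwise (fun e e' => τ e < τ e')} := by
  induction l with
  | nil => simp only [List.Pairwise.nil, MeasurableSet.const]
  | cons e l ih =>
    have heq : {τ : S.Times | (e :: l).Pairwise (fun e e' => τ e < τ e')} =
        (⋂ e' ∈ l, {τ : S.Times | τ e < τ e'}) ∩ {τ | l.Pairwise (fun e e' => τ e < τ e')} := by
      ext τ
      simp only [List.pairwise_cons, Set.mem_inter_iff, Set.mem_iInter, Set.mem_ofPred_eq]
    rw [heq]
    exact (MeasurableSet.iInter fun e' => MeasurableSet.iInter fun _ =>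
      measurableSet_lt (measurable_pi_apply e) (measurable_pi_apply e')).inter ih

theorem measurableSet_ringList_eq (t : ℝ≥0) (l : List S.Ring) :
    MeasurableSet {τ : S.Times | S.ringList τ t = l} := by
  let Q : List S.Ring → Set S.Times :=
    fun l => {τ | l.Pairwise (fun e e' => τ e < τ e') ∧ ∀ e, e ∈ l ↔ τ e ≤ t}
  have hQ : ∀ l, MeasurableSet (Q l) := by
    intro l
    have h2 : MeasurableSet {τ : S.Times | ∀ e, e ∈ l ↔ τ e ≤ t} := by
      have heq : {τ : S.Times | ∀ e, e ∈ l ↔ τ e ≤ t} =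
          ⋂ e, {τ : S.Times | e ∈ l ↔ τ e ≤ t} := by
        ext τ
        simp only [Set.mem_iInter, Set.mem_ofPred_eq]
      rw [heq]
      refine MeasurableSet.iInter fun e => ?_
      have hm : MeasurableSet {τ : S.Times | τ e ≤ t} :=
        measurableSet_le (measurable_pi_apply e) measurable_const
      by_cases he : e ∈ l
      · simpa only [he, true_iff] using hm
      · simpa only [he, false_iff, Set.compl_ofPred] using hm.compl
    exact (measurableSet_pairwise_lt l).inter h2
  -- The value `[]` also stands for the ring times for which there is no ordered list.
  have heq : {τ : S.Times | S.ringList τ t = l} = Q l ∪ ({τ | l = []} ∩ (⋃ l', Q l')ᶜ) := by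
    ext τ
    simp only [Set.mem_union, Set.mem_inter_iff, Set.mem_compl_iff, Set.mem_iUnion,
      Set.mem_ofPred_eq]
    by_cases h : ∃ l', τ ∈ Q l'
    · obtain ⟨l', hl'⟩ := h
      rw [ringList_eq_of hl']
      constructor
      · rintro rfl
        exact Or.inl hl'
      · rintro (hl | ⟨-, hn⟩)
        · exact (ringList_eq_of hl').symm.trans (ringList_eq_of hl)
        · exact absurd ⟨l', hl'⟩ hn
    · have h0 : S.ringList τ t = [] := dif_neg h
      rw [h0]
      constructor
      · intro hl
        exact Or.inr ⟨hl.symm, h⟩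
      · rintro (hl | ⟨hl, -⟩)
        · exact absurd ⟨l, hl⟩ h
        · exact hl.symm
  rw [heq]
  exact (hQ l).union ((MeasurableSet.const _).inter (MeasurableSet.iUnion hQ).compl)

theorem measurable_run {C : ℝ≥0 → Finset (Edge N)} (hC : IsCensoringScheme C) (t : ℝ≥0) :
    Measurable fun ω : Deck N × S.Times × S.Marks => S.run C t ω.1 ω.2.1 ω.2.2 := by
  have hmark : ∀ e : S.Ring,
      Measurable fun ω : Deck N × S.Times × S.Marks => ω.2.2 (e, C (ω.2.1 e)) := by
    intro e
    refine measurable_to_countable' fun π => ?_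
    have heq : (fun ω : Deck N × S.Times × S.Marks => ω.2.2 (e, C (ω.2.1 e))) ⁻¹' {π} =
        ⋃ c, {ω | C (ω.2.1 e) = c} ∩ {ω | ω.2.2 (e, c) = π} := by
      ext ω
      simp
    rw [heq]
    have hτ : Measurable fun ω : Deck N × S.Times × S.Marks => ω.2.1 e :=
      (measurable_pi_apply e).comp (measurable_fst.comp measurable_snd)
    have hu : ∀ c, Measurable fun ω : Deck N × S.Times × S.Marks => ω.2.2 (e, c) := fun c =>
      (measurable_pi_apply (e, c)).comp (measurable_snd.comp measurable_snd)
    exact MeasurableSet.iUnion fun c => (hτ (measurableSet_censoring_eq hC c)).inter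
      (hu c (measurableSet_singleton π))
  have hlist : ∀ l : List S.Ring, Measurable fun ω : Deck N × S.Times × S.Marks =>
      S.runList C ω.2.1 l ω.1 ω.2.2 := by
    intro l
    induction l using List.reverseRecOn with
    | nil => exact measurable_fst
    | append_singleton l e ih =>
      simp only [runList, List.foldl_append, List.foldl_cons, List.foldl_nil]
      exact measurable_mul_deck ih (hmark e)
  intro A hA
  have heq : (fun ω : Deck N × S.Times × S.Marks => S.run C t ω.1 ω.2.1 ω.2.2) ⁻¹' A =
      ⋃ l, {ω | S.ringList ω.2.1 t = l} ∩ (fun ω => S.runList C ω.2.1 l ω.1 ω.2.2) ⁻¹' A := by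
    ext ω
    simp [run, runList]
  rw [heq]
  exact MeasurableSet.iUnion fun l =>
    ((measurable_fst.comp measurable_snd) (measurableSet_ringList_eq t l)).inter (hlist l hA)

instance instIsFiniteMeasureTimesLaw : IsFiniteMeasure S.timesLaw := by
  have h : ∀ e : S.Ring, IsProbabilityMeasure ((expMeasure (S.rate e.1)).map Real.toNNReal) :=
    fun e =>
      haveI := isProbabilityMeasure_expMeasure (S.rate_pos e.1)
      Measure.isProbabilityMeasure_map measurable_real_toNNReal.aemeasurable
  have : IsProbabilityMeasure S.gapLaw := by unfold gapLaw; infer_instance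
  unfold timesLaw
  infer_instance

instance instIsFiniteMeasureLaw (C : ℝ≥0 → Finset (Edge N)) (ν₀ : Measure (Deck N))
    [IsProbabilityMeasure ν₀] (t : ℝ≥0) : IsFiniteMeasure (S.law C ν₀ t) := by
  unfold law; infer_instance

/-- The law of the dynamics is the mixture of its conditional laws given the ring times. -/
theorem law_apply {C : ℝ≥0 → Finset (Edge N)} (hC : IsCensoringScheme C) (ν₀ : Measure (Deck N))
    [IsProbabilityMeasure ν₀] (t : ℝ≥0) (A : Set (Deck N)) :
    S.law C ν₀ t A = ∫⁻ τ, S.condLaw C ν₀ τ t A ∂S.timesLaw := by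
  have hA : MeasurableSet A := MeasurableSet.of_discrete
  have hrun := measurable_run (S := S) hC t
  -- The ring times are moved to the front, to integrate over them last.
  let F : S.Times × Deck N × S.Marks → Deck N × S.Times × S.Marks := fun ω => (ω.2.1, ω.1, ω.2.2)
  have hF : Measurable F := by fun_prop
  have hF' : MeasurePreserving F (S.timesLaw.prod (ν₀.prod S.markLaw))
      (ν₀.prod (S.timesLaw.prod S.markLaw)) := by
    have h1 := (measurePreserving_prodAssoc S.timesLaw ν₀ S.markLaw).symm
    have h2 := (Measure.measurePreserving_swap (μ := S.timesLaw) (ν := ν₀)).prod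
      (MeasurePreserving.id S.markLaw)
    have h3 := measurePreserving_prodAssoc ν₀ S.timesLaw S.markLaw
    exact h3.comp (h2.comp h1)
  unfold law
  rw [Measure.map_apply hrun hA, ← hF'.measure_preimage (hrun hA).nullMeasurableSet,
    Measure.prod_apply (hF (hrun hA))]
  refine lintegral_congr fun τ => ?_
  exact (Measure.map_apply (measurable_runList C τ (S.ringList τ t)) hA).symm

theorem isIncreasing_law (hS : S.HasIntervalBlocks) {C : ℝ≥0 → Finset (Edge N)}
    (hC : IsCensoringScheme C) {ν₀ : Measure (Deck N)} [IsProbabilityMeasure ν₀]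
    (hν₀ : IsIncreasing (density ν₀)) (t : ℝ≥0) : IsIncreasing (density (S.law C ν₀ t)) := by
  rw [isIncreasing_density_iff]
  intro σ σ' hd
  refine (ENNReal.toReal_le_toReal (measure_ne_top _ _) (measure_ne_top _ _)).2 ?_
  rw [law_apply hC, law_apply hC]
  exact lintegral_mono fun τ =>
    (ENNReal.toReal_le_toReal (measure_ne_top _ _) (measure_ne_top _ _)).1
      (isIncreasing_condLaw hS C hν₀ τ t σ σ' hd)

theorem isCensoringScheme_noCensoring : IsCensoringScheme (noCensoring : ℝ≥0 → Finset (Edge N)) :=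
  ⟨fun _ => Eventually.of_forall fun _ => rfl, fun _ => ⟨∅, Eventually.of_forall fun _ => rfl⟩⟩

theorem censoringInequality (hS : S.HasIntervalBlocks) {C : ℝ≥0 → Finset (Edge N)}
    (hC : IsCensoringScheme C) {ν₀ : Measure (Deck N)} [IsProbabilityMeasure ν₀]
    (hν₀ : IsIncreasing (density ν₀)) : S.CensoringInequality C ν₀ := by
  refine ⟨fun t A hA => ?_, fun t τ _ => stochDominates_condLaw hS C hν₀ τ t⟩
  rw [law_apply hC, law_apply isCensoringScheme_noCensoring]
  exact lintegral_mono fun τ => stochDominates_condLaw hS C hν₀ τ t A hA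

end Shuffle

theorem hasIntervalBlocks_skShuffle (N k : ℕ) : (skShuffle N k).HasIntervalBlocks :=
  fun _ => ordConnected_interval _ _ _

theorem hasIntervalBlocks_skShuffleWithBoundaries (N k : ℕ) :
    (skShuffleWithBoundaries N k).HasIntervalBlocks
  | Sum.inl _ => ordConnected_interval _ _ _
  | Sum.inr (Sum.inl _) => ordConnected_interval _ _ _
  | Sum.inr (Sum.inr _) => ordConnected_interval _ _ _

end BlockShuffle

theorem mainTheorem5 (N k : ℕ) (hk : 3 ≤ k) (hkN : k ≤ N)
    (ν₀ : Measure (BlockShuffle.Deck N)) [IsProbabilityMeasure ν₀]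
    (hν₀ : BlockShuffle.IsIncreasing (BlockShuffle.density ν₀))
    (C : ℝ≥0 → Finset (BlockShuffle.Edge N)) (hC : BlockShuffle.IsCensoringScheme C) :
    ((∀ t : ℝ≥0, BlockShuffle.IsIncreasing
        (BlockShuffle.density ((BlockShuffle.skShuffle N k).law C ν₀ t))) ∧
      (BlockShuffle.skShuffle N k).CensoringInequality C ν₀) ∧
    ((∀ t : ℝ≥0, BlockShuffle.IsIncreasing
        (BlockShuffle.density ((BlockShuffle.skShuffleWithBoundaries N k).law C ν₀ t))) ∧
      (BlockShuffle.skShuffleWithBoundaries N k).CensoringInequality C ν₀) := by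
  have h1 := BlockShuffle.hasIntervalBlocks_skShuffle N k
  have h2 := BlockShuffle.hasIntervalBlocks_skShuffleWithBoundaries N k
  exact ⟨⟨BlockShuffle.Shuffle.isIncreasing_law h1 hC hν₀,
    BlockShuffle.Shuffle.censoringInequality h1 hC hν₀⟩,
    ⟨BlockShuffle.Shuffle.isIncreasing_law h2 hC hν₀,
    BlockShuffle.Shuffle.censoringInequality h2 hC hν₀⟩⟩
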